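/- Identify $\mathbf R^3$ with $\mathbf C\times\mathbf R$, with coordinates $(w,h)$, and let $\langle (w,h),(w',h')\rangle = hh'-\operatorname{Re}(\bar w w')$ be the Lorentzian scalar product. Let $\mathbf H^2=\{(w,h): h>0,\ h^2-|w|^2=1\}$ be the hyperbolic plane, with distance $d$ given by $\cosh d(p,q)=\langle p,q\rangle$, geodesics the intersections of $\mathbf H^2$ with planes through the origin, and oriented area element $\sinh\theta\,d\theta\wedge d\varphi$ in the coordinates $w=\sinh\theta\,e^{i\varphi}$, $h=\cosh\theta$. For $a,b,c\in\mathbf H^2$ let $\Delta(abc)$ be the (possibly degenerate) geodesic triangle with ordered corners $a,b,c$; its oriented area $\Omega$ is the area of the filled triangle, with sign $+$ if $(a,b,c)$ is positively oriented ($\det(abc)>0$) and $-$ if it is negatively oriented ($\det(abc)<0$), and $\Omega=0$ if $\Delta(abc)$ is degenerate. Here $\det(pqr)$ is the determinant of three vectors in the coordinates $(\operatorname{Re}w,\operatorname{Im}w,h)$. **Proposition.** Let $\alpha,\beta,\gamma\in\mathbf H^2$. There exists a triangle $\Delta(abc)$ such that $\alpha,\beta,\gamma$ are the midpoints of its sides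 $\overline{bc},\overline{ca},\overline{ab}$ respectively if and only if $|\det(\alpha\beta\gamma)|<1$, and in that case this triangle is unique. Its oriented area $\Omega$ then lies in $(-\pi,\pi)$ and satisfies $$e^{i\Omega/2}=\sqrt{1-\det(\alpha\beta\gamma)^2}+i\det(\alpha\beta\gamma).$$ -/

import Mathlib

noncomputable section

/-- The Lorentzian scalar product on `ℝ³ = ℂ × ℝ`, with coordinates `(w, h)`:
`⟨(w, h), (w', h')⟩ = h h' - Re (conj w * w')`. -/
def lorentz (p q : ℂ × ℝ) : ℝ :=
  p.2 * q.2 - (starRingEnd ℂ p.1 * q.1).re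

/-- The hyperbolic plane: the upper sheet `h > 0` of the hyperboloid `h² - |w|² = 1`. -/
def HyperbolicPlane : Type :=
  {p : ℂ × ℝ // 0 < p.2 ∧ p.2 ^ 2 - ‖p.1‖ ^ 2 = 1}

/-- The determinant of three vectors of `ℂ × ℝ = ℝ³`, in the coordinates `(Re w, Im w, h)`. -/
def det3 (p q r : ℂ × ℝ) : ℝ :=
  Matrix.det !![p.1.re, p.1.im, p.2; q.1.re, q.1.im, q.2; r.1.re, r.1.im, r.2]

namespace HyperbolicPlane

/-- The hyperbolic distance, `cosh d(p, q) = ⟨p, q⟩`. -/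
def hdist (p q : HyperbolicPlane) : ℝ :=
  Real.arcosh (lorentz p.1 q.1)

/-- The geodesic segment from `p` to `q`: geodesics are the intersections of the hyperboloid
with planes through the origin, and the segment is the part in the cone spanned by `p`, `q`. -/
def geodesicSegment (p q : HyperbolicPlane) : Set HyperbolicPlane :=
  {x | ∃ s t : ℝ, 0 ≤ s ∧ 0 ≤ t ∧ x.1 = s • p.1 + t • q.1}

/-- `m` is the midpoint of the geodesic segment from `p` to `q`. -/
def IsMidpoint (m p q : HyperbolicPlane) : Prop :=
  m ∈ geodesicSegment p q ∧ hdist p m = hdist m q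

end HyperbolicPlane

/-- Hyperbolic coordinates `(θ, φ) ↦ (w, h) = (sinh θ * exp (i φ), cosh θ)`. -/
def hyperbolicCoord (x : ℝ × ℝ) : ℂ × ℝ :=
  ((Real.sinh x.1 : ℂ) * Complex.exp (Complex.I * (x.2 : ℂ)), Real.cosh x.1)

/-- The hyperbolic area measure, `sinh θ dθ dφ` on `θ > 0`, `-π < φ < π`. It is carried by
the hyperbolic plane; the points missed by the coordinates form a null set. -/
def hyperbolicArea : MeasureTheory.Measure (ℂ × ℝ) :=
  (((MeasureTheory.volume : MeasureTheory.Measure (ℝ × ℝ)).restrict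
      (Set.Ioi 0 ×ˢ Set.Ioo (-Real.pi) Real.pi)).withDensity
    (fun x => ENNReal.ofReal (Real.sinh x.1))).map hyperbolicCoord

/-- A geodesic triangle `Δ(abc)`, given by its ordered corners; it may be degenerate. -/
structure HyperbolicTriangle where
  a : HyperbolicPlane
  b : HyperbolicPlane
  c : HyperbolicPlane

namespace HyperbolicTriangle

/-- The filled triangle: the points of the hyperbolic plane in the cone spanned by the corners. -/
def region (T : HyperbolicTriangle) : Set (ℂ × ℝ) :=
  {x | (0 < x.2 ∧ x.2 ^ 2 - ‖x.1‖ ^ 2 = 1) ∧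
    ∃ r s t : ℝ, 0 ≤ r ∧ 0 ≤ s ∧ 0 ≤ t ∧ x = r • T.a.1 + s • T.b.1 + t • T.c.1}

/-- The oriented area: the area of the filled triangle, counted positively when `a, b, c` is
positively oriented for `dθ ∧ dφ` (counterclockwise in the `w`-plane), which means that
`det (a b c) > 0`, and negatively when it is negatively oriented. -/
def orientedArea (T : HyperbolicTriangle) : ℝ :=
  Real.sign (det3 T.a.1 T.b.1 T.c.1) * (hyperbolicArea T.region).toReal

/-- `α`, `β`, `γ` are the midpoints of the sides `bc`, `ca`, `ab` respectively. -/
def HasMidpoints (T : HyperbolicTriangle) (α β γ : HyperbolicPlane) : Prop :=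
  HyperbolicPlane.IsMidpoint α T.b T.c ∧ HyperbolicPlane.IsMidpoint β T.c T.a ∧
    HyperbolicPlane.IsMidpoint γ T.a T.b

end HyperbolicTriangle

end

/-! A point m is the midpoint of pq exactly when p + q is a positive multiple of m
(`isMidpoint_iff`), so the midpoint conditions are linear: b + c = 2pα, c + a = 2qβ, a + b = 2rγ
with p, q, r > 0. Put D = det(abc) and S = 1 + ⟨b,c⟩ + ⟨c,a⟩ + ⟨a,b⟩ > 0. Then D = 4pqr det(αβγ),
and a Gram identity gives (4pqr)² = S² + D² (`sq_midpoint_scales`). Hence √(1 - det(αβγ)²) and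
det(αβγ) are the real and imaginary parts of (S + iD)/|S + iD|, and |det(αβγ)| < 1. The corners are
then explicit in the midpoints (`HasMidpoints.smul_corner_a`), which gives uniqueness and, read
backwards, existence.

It remains to show that Ω/2 is the argument of S + iD, that is, Ω = 2 arctan(D/S). Central
projection to the plane h = 1 turns hyperbolic area into the integral of (1 - |k|²)^(-3/2), which is
three times the Euclidean volume of the part ⟨v,v⟩ ≤ 1 of the solid cone over the triangle
(`three_mul_volume_cone`). Volume transforms simply under linear maps: the coordinates v = ra + sb +
tc replace the cone by the octant at the cost of a factor |D|, and there the integral is elementary.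
-/

lemma lorentz_eq (p q : ℂ × ℝ) :
    lorentz p q = p.2 * q.2 - p.1.re * q.1.re - p.1.im * q.1.im := by
  simp [lorentz]; ring

lemma lorentz_comm (p q : ℂ × ℝ) : lorentz p q = lorentz q p := by
  simp only [lorentz_eq]; ring

lemma lorentz_add_left (p q r : ℂ × ℝ) : lorentz (p + q) r = lorentz p r + lorentz q r := by
  simp [lorentz_eq]; ring

lemma lorentz_smul_left (s : ℝ) (p q : ℂ × ℝ) : lorentz (s • p) q = s * lorentz p q := by
  simp [lorentz_eq]; ring

lemma lorentz_add_right (p q r : ℂ × ℝ) : lorentz r (p + q) = lorentz r p + lorentz r q := by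
  simp [lorentz_eq]; ring

lemma lorentz_smul_right (s : ℝ) (p q : ℂ × ℝ) : lorentz q (s • p) = s * lorentz q p := by
  simp [lorentz_eq]; ring

lemma det3_eq (p q r : ℂ × ℝ) : det3 p q r =
    p.1.re * q.1.im * r.2 - p.1.re * q.2 * r.1.im - p.1.im * q.1.re * r.2
      + p.1.im * q.2 * r.1.re + p.2 * q.1.re * r.1.im - p.2 * q.1.im * r.1.re := by
  simp [det3, Matrix.det_fin_three]

/-- The Gram determinant of three vectors for the Lorentzian scalar product. -/
lemma det3_sq (p q r : ℂ × ℝ) : det3 p q r ^ 2 =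
    lorentz p p * lorentz q q * lorentz r r + 2 * lorentz q r * lorentz r p * lorentz p q
      - lorentz p p * lorentz q r ^ 2 - lorentz q q * lorentz r p ^ 2
      - lorentz r r * lorentz p q ^ 2 := by
  simp only [det3_eq, lorentz_eq]; ring

/-- The map (a, b, c) ↦ (b + c, c + a, a + b) has determinant 2. -/
lemma det3_midpoints (a b c α β γ : ℂ × ℝ) (p q r : ℝ) (hα : b + c = (2 * p) • α)
    (hβ : c + a = (2 * q) • β) (hγ : a + b = (2 * r) • γ) :
    det3 a b c = 4 * (p * q * r) * det3 α β γ := by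
  have h1 : det3 (b + c) (c + a) (a + b) = 2 * det3 a b c := by
    simp only [det3_eq, Prod.fst_add, Prod.snd_add, Complex.add_re, Complex.add_im]; ring
  have h2 : det3 ((2 * p) • α) ((2 * q) • β) ((2 * r) • γ) = 8 * (p * q * r) * det3 α β γ := by
    simp only [det3_eq, Prod.smul_fst, Prod.smul_snd, Complex.smul_re, Complex.smul_im,
      smul_eq_mul]
    ring
  rw [← hα, ← hβ, ← hγ, h1] at h2
  linarith

/-! ### Midpoints on the hyperboloid -/

namespace HyperbolicPlane

lemma lorentz_self (p : HyperbolicPlane) : lorentz p.1 p.1 = 1 := by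
  have h := p.2.2
  rw [← Complex.normSq_eq_norm_sq, Complex.normSq_apply] at h
  rw [lorentz_eq]; linarith

/-- A vector of Lorentzian square one with positive height, as a point of the hyperbolic plane. -/
def ofLorentz (v : ℂ × ℝ) (hv : 0 < v.2) (h : lorentz v v = 1) : HyperbolicPlane :=
  ⟨v, hv, by
    rw [← Complex.normSq_eq_norm_sq, Complex.normSq_apply]
    rw [lorentz_eq] at h; linarith⟩

/-- Reversed Cauchy–Schwarz: for planar vectors, (1 + |u|²)(1 + |v|²) - (1 + u·v)² = |u - v|² + (u ×
v)². -/
lemma one_le_lorentz (p q : HyperbolicPlane) : 1 ≤ lorentz p.1 q.1 := by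
  have hp := p.lorentz_self
  have hq := q.lorentz_self
  have hp0 := p.2.1
  have hq0 := q.2.1
  rw [lorentz_eq] at *
  have : 1 + p.1.1.re * q.1.1.re + p.1.1.im * q.1.1.im ≤ p.1.2 * q.1.2 := by
    apply le_of_sq_le_sq _ (by positivity)
    have e : (p.1.2 * q.1.2) ^ 2 = (1 + p.1.1.re ^ 2 + p.1.1.im ^ 2) *
        (1 + q.1.1.re ^ 2 + q.1.1.im ^ 2) := by
      rw [mul_pow]; congr 1 <;> linarith
    rw [e]
    nlinarith [sq_nonneg (p.1.1.re - q.1.1.re), sq_nonneg (p.1.1.im - q.1.1.im),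
      sq_nonneg (p.1.1.re * q.1.1.im - p.1.1.im * q.1.1.re)]
  linarith

lemma eq_of_lorentz_eq_one {p q : HyperbolicPlane} (h : lorentz p.1 q.1 = 1) : p = q := by
  have hp := p.lorentz_self
  have hq := q.lorentz_self
  have hp0 := p.2.1
  have hq0 := q.2.1
  rw [lorentz_eq] at *
  have e : (1 + p.1.1.re * q.1.1.re + p.1.1.im * q.1.1.im) ^ 2 =
      (1 + p.1.1.re ^ 2 + p.1.1.im ^ 2) * (1 + q.1.1.re ^ 2 + q.1.1.im ^ 2) := by
    rw [show 1 + p.1.1.re * q.1.1.re + p.1.1.im * q.1.1.im = p.1.2 * q.1.2 by linarith, mul_pow]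
    congr 1 <;> linarith
  have e2 : (p.1.1.re - q.1.1.re) ^ 2 + (p.1.1.im - q.1.1.im) ^ 2 +
      (p.1.1.re * q.1.1.im - p.1.1.im * q.1.1.re) ^ 2 = 0 := by linear_combination -e
  have h1 : p.1.1.re = q.1.1.re := by
    nlinarith [sq_nonneg (p.1.1.im - q.1.1.im), sq_nonneg (p.1.1.re - q.1.1.re),
      sq_nonneg (p.1.1.re * q.1.1.im - p.1.1.im * q.1.1.re)]
  have h2 : p.1.1.im = q.1.1.im := by
    nlinarith [sq_nonneg (p.1.1.im - q.1.1.im), sq_nonneg (p.1.1.re - q.1.1.re),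
      sq_nonneg (p.1.1.re * q.1.1.im - p.1.1.im * q.1.1.re)]
  have h3 : p.1.2 = q.1.2 := by
    rw [h1, h2] at hp
    exact (sq_eq_sq₀ hp0.le hq0.le).1 (by linarith)
  exact Subtype.ext (Prod.ext (Complex.ext h1 h2) h3)

/-- For m = sp + tq, equidistance reads (s - t)(1 - ⟨p,q⟩) = 0, so either s = t or the segment is a
point. -/
lemma isMidpoint_iff (m p q : HyperbolicPlane) :
    IsMidpoint m p q ↔ ∃ k : ℝ, 0 < k ∧ p.1 + q.1 = (2 * k) • m.1 := by
  have hpp := p.lorentz_self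
  have hqq := q.lorentz_self
  constructor
  · rintro ⟨⟨s, t, hs, ht, hm⟩, hd⟩
    have hl : lorentz p.1 m.1 = lorentz m.1 q.1 :=
      Real.arcosh_injOn (one_le_lorentz p m) (one_le_lorentz m q) hd
    rw [hm, lorentz_add_left, lorentz_add_right, lorentz_smul_left, lorentz_smul_left,
      lorentz_smul_right, lorentz_smul_right, hpp, hqq] at hl
    have h0 : (s - t) * (1 - lorentz p.1 q.1) = 0 := by linarith
    rcases mul_eq_zero.1 h0 with h | h
    · have hst : s = t := by linarith
      subst hst
      have hs0 : 0 < s := by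
        rcases hs.lt_or_eq with h | h
        · exact h
        · have := m.2.1
          rw [hm, ← h] at this
          simp at this
      refine ⟨1 / (2 * s), by positivity, ?_⟩
      rw [hm, ← smul_add, smul_smul]
      rw [show 2 * (1 / (2 * s)) * s = 1 by field_simp, one_smul]
    · have hpq : p = q := eq_of_lorentz_eq_one (by linarith)
      subst hpq
      have hm' : m.1 = (s + t) • p.1 := by rw [hm, add_smul]
      have h1 : (s + t) * (s + t) = 1 := by
        have := m.lorentz_self
        rw [hm', lorentz_smul_left, lorentz_smul_right, hpp] at this
        linarith
      have h2 : s + t = 1 := by nlinarith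
      refine ⟨1, one_pos, ?_⟩
      rw [hm', h2, one_smul, mul_one, two_smul]
  · rintro ⟨k, hk, h⟩
    have hm : m.1 = (1 / (2 * k)) • p.1 + (1 / (2 * k)) • q.1 := by
      rw [← smul_add, h, smul_smul, show 1 / (2 * k) * (2 * k) = 1 by field_simp, one_smul]
    refine ⟨⟨1 / (2 * k), 1 / (2 * k), by positivity, by positivity, hm⟩, ?_⟩
    unfold hdist
    congr 1
    rw [hm, lorentz_add_left, lorentz_add_right, lorentz_smul_left, lorentz_smul_left,
      lorentz_smul_right, lorentz_smul_right, hpp, hqq]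
    ring

lemma lorentz_of_add_eq {m p q : HyperbolicPlane} {k : ℝ} (h : p.1 + q.1 = (2 * k) • m.1) :
    2 * k ^ 2 = 1 + lorentz p.1 q.1 := by
  have : lorentz (p.1 + q.1) (p.1 + q.1) = 4 * k ^ 2 := by
    rw [h, lorentz_smul_left, lorentz_smul_right, lorentz_self]; ring
  simp only [lorentz_add_left, lorentz_add_right, lorentz_self, lorentz_comm q.1 p.1] at this
  linarith

end HyperbolicPlane

/-- Two vectors of Lorentzian square one whose sum is a positive multiple of a point of the
hyperbolic plane lie on the upper sheet. -/
lemma snd_pos_of_add_eq_smul {u v : ℂ × ℝ} {m : HyperbolicPlane} {k : ℝ} (hk : 0 < k)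
    (hu : lorentz u u = 1) (hv : lorentz v v = 1) (h : u + v = k • m.1) : 0 < u.2 := by
  by_contra! hu0
  have hu1 : u.2 < 0 := by
    rcases hu0.lt_or_eq with h | h
    · exact h
    · rw [lorentz_eq, h] at hu
      nlinarith [sq_nonneg u.1.re, sq_nonneg u.1.im]
  have hs : u.2 + v.2 = k * m.1.2 := by simpa using congrArg Prod.snd h
  have hv1 : 0 < v.2 := by nlinarith [mul_pos hk m.2.1]
  -- With -u and v both on the upper sheet, ⟨u,v⟩ ≤ -1, so u + v has square 2 + 2⟨u,v⟩ ≤ 0, whereas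
  -- that square is k².
  let u' := HyperbolicPlane.ofLorentz (-u) (by simpa using hu1) (by
    simp only [lorentz_eq, Prod.fst_neg, Prod.snd_neg, Complex.neg_re, Complex.neg_im] at hu ⊢
    linarith)
  have h1 := HyperbolicPlane.one_le_lorentz u' (HyperbolicPlane.ofLorentz v hv1 hv)
  have h2 : 1 ≤ lorentz (-u) v := h1
  have h3 : lorentz (u + v) (u + v) = k ^ 2 := by
    rw [h, lorentz_smul_left, lorentz_smul_right, m.lorentz_self]; ring
  rw [lorentz_add_left, lorentz_add_right, lorentz_add_right, hu, hv, lorentz_comm v u] at h3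
  have h4 : lorentz (-u) v = - lorentz u v := by
    simp [lorentz_eq]; ring
  nlinarith [pow_pos hk 2]

/-! ### Triangles with prescribed midpoints -/

noncomputable section

namespace HyperbolicTriangle

/-- The sum `1 + cosh d(b, c) + cosh d(c, a) + cosh d(a, b)`. -/
def coshSum (T : HyperbolicTriangle) : ℝ :=
  1 + lorentz T.b.1 T.c.1 + lorentz T.c.1 T.a.1 + lorentz T.a.1 T.b.1

lemma coshSum_pos (T : HyperbolicTriangle) : 0 < T.coshSum := by
  have h1 := T.b.one_le_lorentz T.c
  have h2 := T.c.one_le_lorentz T.a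
  have h3 := T.a.one_le_lorentz T.b
  unfold coshSum
  linarith

/-- The determinant of the corners. -/
def det (T : HyperbolicTriangle) : ℝ := det3 T.a.1 T.b.1 T.c.1

lemma det_sq (T : HyperbolicTriangle) : T.det ^ 2 =
    1 + 2 * lorentz T.b.1 T.c.1 * lorentz T.c.1 T.a.1 * lorentz T.a.1 T.b.1
      - lorentz T.b.1 T.c.1 ^ 2 - lorentz T.c.1 T.a.1 ^ 2 - lorentz T.a.1 T.b.1 ^ 2 := by
  rw [det, det3_sq, T.a.lorentz_self, T.b.lorentz_self, T.c.lorentz_self]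
  ring

lemma hasMidpoints_iff (T : HyperbolicTriangle) (α β γ : HyperbolicPlane) :
    T.HasMidpoints α β γ ↔ ∃ p q r : ℝ, 0 < p ∧ 0 < q ∧ 0 < r ∧
      T.b.1 + T.c.1 = (2 * p) • α.1 ∧ T.c.1 + T.a.1 = (2 * q) • β.1 ∧
      T.a.1 + T.b.1 = (2 * r) • γ.1 := by
  unfold HasMidpoints
  simp only [HyperbolicPlane.isMidpoint_iff]
  constructor
  · rintro ⟨⟨p, hp, h1⟩, ⟨q, hq, h2⟩, ⟨r, hr, h3⟩⟩
    exact ⟨p, q, r, hp, hq, hr, h1, h2, h3⟩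
  · rintro ⟨p, q, r, hp, hq, hr, h1, h2, h3⟩
    exact ⟨⟨p, hp, h1⟩, ⟨q, hq, h2⟩, ⟨r, hr, h3⟩⟩

variable {T : HyperbolicTriangle} {α β γ : HyperbolicPlane} {p q r : ℝ}

/-- Since 2p² = 1 + x with x = ⟨b,c⟩, and similarly for y and z, this is the identity 2(1 + x)(1 +
y)(1 + z) = (1 + x + y + z)² + (1 + 2xyz - x² - y² - z²). -/
lemma sq_midpoint_scales (hα : T.b.1 + T.c.1 = (2 * p) • α.1)
    (hβ : T.c.1 + T.a.1 = (2 * q) • β.1) (hγ : T.a.1 + T.b.1 = (2 * r) • γ.1) :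
    (4 * (p * q * r)) ^ 2 = T.coshSum ^ 2 + T.det ^ 2 := by
  have h1 := HyperbolicPlane.lorentz_of_add_eq hα
  have h2 := HyperbolicPlane.lorentz_of_add_eq hβ
  have h3 := HyperbolicPlane.lorentz_of_add_eq hγ
  rw [det_sq, coshSum]
  calc (4 * (p * q * r)) ^ 2 = 2 * ((2 * p ^ 2) * (2 * q ^ 2) * (2 * r ^ 2)) := by ring
    _ = _ := by rw [h1, h2, h3]; ring

lemma HasMidpoints.det3_eq_div (h : T.HasMidpoints α β γ) :
    det3 α.1 β.1 γ.1 = T.det / √(T.coshSum ^ 2 + T.det ^ 2) := by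
  obtain ⟨p, q, r, hp, hq, hr, hα, hβ, hγ⟩ := (hasMidpoints_iff T α β γ).1 h
  have h1 : T.det = 4 * (p * q * r) * det3 α.1 β.1 γ.1 := det3_midpoints _ _ _ _ _ _ _ _ _ hα hβ hγ
  rw [← sq_midpoint_scales hα hβ hγ, Real.sqrt_sq (by positivity), h1]
  field_simp

lemma HasMidpoints.one_sub_det3_sq (h : T.HasMidpoints α β γ) :
    1 - det3 α.1 β.1 γ.1 ^ 2 = (T.coshSum / √(T.coshSum ^ 2 + T.det ^ 2)) ^ 2 := by
  have := T.coshSum_pos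
  rw [h.det3_eq_div, div_pow, div_pow, Real.sq_sqrt (by positivity)]
  field_simp
  ring

lemma HasMidpoints.abs_det3_lt_one (h : T.HasMidpoints α β γ) : |det3 α.1 β.1 γ.1| < 1 := by
  have := T.coshSum_pos
  rw [← sq_lt_one_iff_abs_lt_one, ← sub_pos, h.one_sub_det3_sq]
  positivity

lemma HasMidpoints.sqrt_one_sub_det3_sq (h : T.HasMidpoints α β γ) :
    √(1 - det3 α.1 β.1 γ.1 ^ 2) = T.coshSum / √(T.coshSum ^ 2 + T.det ^ 2) := by
  have := T.coshSum_pos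
  rw [h.one_sub_det3_sq, Real.sqrt_sq (by positivity)]

/-- The corners of a triangle in terms of the midpoints of its sides. -/
lemma HasMidpoints.smul_corner_a (h : T.HasMidpoints α β γ) :
    √(1 - det3 α.1 β.1 γ.1 ^ 2) • T.a.1 = -(lorentz β.1 γ.1 • α.1) + lorentz γ.1 α.1 • β.1
      + lorentz α.1 β.1 • γ.1 := by
  rw [h.sqrt_one_sub_det3_sq]
  obtain ⟨p, q, r, hp, hq, hr, hα, hβ, hγ⟩ := (hasMidpoints_iff T α β γ).1 h
  rw [← sq_midpoint_scales hα hβ hγ, Real.sqrt_sq (by positivity)]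
  -- Two sides share the corner v, and ⟨u + v, v + w⟩ is the symmetric sum S. So each product of two
  -- midpoints is S/(4pqr) times the scale of the third.
  have e (u v w m n : ℂ × ℝ) (x y : ℝ) (hx : 0 < x) (hy : 0 < y) (h1 : u + v = (2 * x) • m)
      (h2 : v + w = (2 * y) • n) (hv : lorentz v v = 1) :
      lorentz m n = (1 + lorentz v w + lorentz w u + lorentz u v) / (4 * (x * y)) := by
    have : lorentz (u + v) (v + w) = 4 * (x * y) * lorentz m n := by
      rw [h1, h2, lorentz_smul_left, lorentz_smul_right]; ring
    rw [eq_div_iff (by positivity)]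
    rw [lorentz_add_left, lorentz_add_right, lorentz_add_right, hv, lorentz_comm u w] at this
    linarith
  have hX : lorentz β.1 γ.1 = T.coshSum / (4 * (p * q * r)) * p := by
    rw [e _ _ _ _ _ q r hq hr hβ hγ T.a.lorentz_self, coshSum]
    field_simp
    ring
  have hY : lorentz γ.1 α.1 = T.coshSum / (4 * (p * q * r)) * q := by
    rw [e _ _ _ _ _ r p hr hp hγ hα T.b.lorentz_self, coshSum]
    field_simp
  have hZ : lorentz α.1 β.1 = T.coshSum / (4 * (p * q * r)) * r := by
    rw [e _ _ _ _ _ p q hp hq hα hβ T.c.lorentz_self, coshSum]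
    field_simp
    ring
  have ha : (2 : ℝ) • T.a.1 = -((2 * p) • α.1) + (2 * q) • β.1 + (2 * r) • γ.1 := by
    rw [← hα, ← hβ, ← hγ, two_smul]; abel
  have ha' : T.a.1 = -(p • α.1) + q • β.1 + r • γ.1 := by
    apply smul_right_injective _ (two_ne_zero (α := ℝ))
    simp only [ha, smul_add, smul_neg, smul_smul]
  rw [hX, hY, hZ]
  conv_lhs => rw [ha']
  simp only [smul_add, smul_neg, smul_smul]

/-- Cyclic permutation of the corners. -/
def rotate (T : HyperbolicTriangle) : HyperbolicTriangle := ⟨T.b, T.c, T.a⟩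

lemma HasMidpoints.rotate (h : T.HasMidpoints α β γ) : T.rotate.HasMidpoints β γ α :=
  ⟨h.2.1, h.2.2, h.1⟩

lemma HasMidpoints.corner_a_eq {T' : HyperbolicTriangle} (h : T.HasMidpoints α β γ)
    (h' : T'.HasMidpoints α β γ) : T.a = T'.a := by
  have hpos : 0 < √(1 - det3 α.1 β.1 γ.1 ^ 2) := by
    have := T.coshSum_pos
    rw [h.sqrt_one_sub_det3_sq]
    positivity
  exact Subtype.ext (smul_right_injective _ hpos.ne' (h.smul_corner_a.trans h'.smul_corner_a.symm))

lemma HasMidpoints.unique {T' : HyperbolicTriangle} (h : T.HasMidpoints α β γ)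
    (h' : T'.HasMidpoints α β γ) : T = T' := by
  have ha := h.corner_a_eq h'
  have hb := h.rotate.corner_a_eq h'.rotate
  have hc := h.rotate.rotate.corner_a_eq h'.rotate.rotate
  cases T; cases T'
  simp only [HyperbolicTriangle.rotate] at ha hb hc
  rw [ha, hb, hc]

/-- The corner formula of `HasMidpoints.smul_corner_a` and its cyclic versions serve as definitions
of a, b, c. -/
lemma exists_hasMidpoints (h : |det3 α.1 β.1 γ.1| < 1) :
    ∃ T : HyperbolicTriangle, T.HasMidpoints α β γ := by
  have hN0 : 0 < 1 - det3 α.1 β.1 γ.1 ^ 2 := by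
    rw [sub_pos, sq_lt_one_iff_abs_lt_one]; exact h
  have hdet := det3_sq α.1 β.1 γ.1
  rw [α.lorentz_self, β.lorentz_self, γ.lorentz_self] at hdet
  have hX := β.one_le_lorentz γ
  have hY := γ.one_le_lorentz α
  have hZ := α.one_le_lorentz β
  set X := lorentz β.1 γ.1 with hX_def
  set Y := lorentz γ.1 α.1 with hY_def
  set Z := lorentz α.1 β.1 with hZ_def
  set N := √(1 - det3 α.1 β.1 γ.1 ^ 2) with hN_def
  have hN : 0 < N := Real.sqrt_pos.2 hN0
  have hN2 : N ^ 2 = 1 - det3 α.1 β.1 γ.1 ^ 2 := Real.sq_sqrt hN0.le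
  -- Flipping the sign of exactly one of X, Y, Z satisfies `hxyz`; the square of xα + yβ + zγ is
  -- then X² + Y² + Z² - 2XYZ = 1 - det(αβγ)².
  have key (x y z : ℝ) (hx : x ^ 2 = X ^ 2) (hy : y ^ 2 = Y ^ 2) (hz : z ^ 2 = Z ^ 2)
      (hxyz : x * y * Z + y * z * X + z * x * Y = - (X * Y * Z)) :
      lorentz (N⁻¹ • (x • α.1 + y • β.1 + z • γ.1)) (N⁻¹ • (x • α.1 + y • β.1 + z • γ.1)) = 1 := by
    simp only [lorentz_add_left, lorentz_add_right, lorentz_smul_left, lorentz_smul_right,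
      α.lorentz_self, β.lorentz_self, γ.lorentz_self, lorentz_comm β.1 α.1, lorentz_comm γ.1 β.1,
      lorentz_comm α.1 γ.1, ← hX_def, ← hY_def, ← hZ_def]
    field_simp
    rw [hN2, hdet]
    linear_combination hx + hy + hz + 2 * hxyz
  have ha := key (-X) Y Z (by ring) rfl rfl (by ring)
  have hb := key X (-Y) Z rfl (by ring) rfl (by ring)
  have hc := key X Y (-Z) rfl rfl (by ring) (by ring)
  set a := N⁻¹ • (-X • α.1 + Y • β.1 + Z • γ.1) with ha_def
  set b := N⁻¹ • (X • α.1 + -Y • β.1 + Z • γ.1) with hb_def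
  set c := N⁻¹ • (X • α.1 + Y • β.1 + -Z • γ.1) with hc_def
  have hα : b + c = (2 * (N⁻¹ * X)) • α.1 := by
    rw [hb_def, hc_def]; module
  have hβ : c + a = (2 * (N⁻¹ * Y)) • β.1 := by
    rw [hc_def, ha_def]; module
  have hγ : a + b = (2 * (N⁻¹ * Z)) • γ.1 := by
    rw [ha_def, hb_def]; module
  refine ⟨⟨.ofLorentz a (snd_pos_of_add_eq_smul (by positivity) ha hb hγ) ha,
    .ofLorentz b (snd_pos_of_add_eq_smul (by positivity) hb hc hα) hb,
    .ofLorentz c (snd_pos_of_add_eq_smul (by positivity) hc ha hβ) hc⟩, ?_⟩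
  rw [hasMidpoints_iff]
  exact ⟨N⁻¹ * X, N⁻¹ * Y, N⁻¹ * Z, by positivity, by positivity, by positivity, hα, hβ, hγ⟩

end HyperbolicTriangle

end

/-! ### One-variable integrals for the area -/

section

open MeasureTheory Filter Topology Set

/-- The fundamental theorem of calculus on a half-line for a nonnegative derivative. -/
lemma lintegral_Ioi_of_hasDerivAt_of_nonneg {f f' : ℝ → ℝ} {l : ℝ}
    (hderiv : ∀ x ∈ Ici (0 : ℝ), HasDerivAt f (f' x) x) (hpos : ∀ x ∈ Ioi (0 : ℝ), 0 ≤ f' x)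
    (hlim : Tendsto f atTop (𝓝 l)) :
    ∫⁻ x in Ioi (0 : ℝ), ENNReal.ofReal (f' x) = ENNReal.ofReal (l - f 0) := by
  have hint := integrableOn_Ioi_deriv_of_nonneg' hderiv hpos hlim
  rw [← integral_Ioi_of_hasDerivAt_of_nonneg' hderiv hpos hlim]
  rw [ofReal_integral_eq_lintegral_ofReal hint]
  exact (ae_restrict_iff' measurableSet_Ioi).2 (Eventually.of_forall hpos)

lemma hasDerivAt_sqrt_quadratic (b c t : ℝ) (h : 0 < t ^ 2 + 2 * b * t + c) :
    HasDerivAt (fun t => √(t ^ 2 + 2 * b * t + c)) ((t + b) / √(t ^ 2 + 2 * b * t + c)) t := by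
  have h1 : HasDerivAt (fun t : ℝ => t ^ 2 + 2 * b * t + c) (2 * (t + b)) t := by
    have := (((hasDerivAt_id t).pow 2).add ((hasDerivAt_id t).const_mul (2 * b))).add_const c
    refine this.congr_deriv ?_
    simp; ring
  refine (h1.sqrt h.ne').congr_deriv ?_
  field_simp

/-- An antiderivative is (t + b)/((c - b²)√(t² + 2bt + c)). -/
lemma lintegral_rpow_quadratic (b c : ℝ) (hb : 0 ≤ b) (hc : 0 < c) (hbc : c < b ^ 2) :
    ∫⁻ t in Ioi (0 : ℝ), ENNReal.ofReal (1 / √(t ^ 2 + 2 * b * t + c) ^ 3) =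
      ENNReal.ofReal (1 / (√c * (√c + b))) := by
  have hd : c - b ^ 2 ≠ 0 := by linarith
  have hq (t : ℝ) (ht : 0 ≤ t) : 0 < t ^ 2 + 2 * b * t + c := by positivity
  have hsc : 0 < √c := Real.sqrt_pos.2 hc
  rw [lintegral_Ioi_of_hasDerivAt_of_nonneg
    (f := fun t => (t + b) / √(t ^ 2 + 2 * b * t + c) / (c - b ^ 2)) (l := 1 / (c - b ^ 2))]
  · congr 1
    simp only [zero_add, mul_zero, ne_eq, OfNat.ofNat_ne_zero, not_false_eq_true, zero_pow]
    have h2 : c = √c ^ 2 := (Real.sq_sqrt hc.le).symm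
    have h3 : √c + b ≠ 0 := by positivity
    field_simp
    linear_combination -h2
  · intro t ht
    have hqt := hq t ht
    have hR : 0 < √(t ^ 2 + 2 * b * t + c) := Real.sqrt_pos.2 hqt
    have hR2 : √(t ^ 2 + 2 * b * t + c) ^ 2 = t ^ 2 + 2 * b * t + c := Real.sq_sqrt hqt.le
    refine ((((hasDerivAt_id t).add_const b).div (hasDerivAt_sqrt_quadratic b c t hqt)
      hR.ne').div_const (c - b ^ 2)).congr_deriv ?_
    simp only [id]
    set R := √(t ^ 2 + 2 * b * t + c)
    field_simp
    linear_combination hR2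
  · intro t ht
    positivity
  · refine Tendsto.div_const ?_ _
    -- In the variable u = 1/t the limit is continuity at u = 0.
    have h1 : Tendsto (fun t : ℝ => (1 + b * t⁻¹) / √(1 + 2 * b * t⁻¹ + c * t⁻¹ ^ 2)) atTop
        (𝓝 1) := by
      have hcont : ContinuousAt (fun u : ℝ => (1 + b * u) / √(1 + 2 * b * u + c * u ^ 2)) 0 := by
        apply ContinuousAt.div (by fun_prop) (by fun_prop)
        simp
      have := hcont.tendsto.comp tendsto_inv_atTop_zero
      simpa [Function.comp_def] using this
    refine h1.congr' ?_
    filter_upwards [eventually_gt_atTop 0] with t ht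
    have : √(t ^ 2 + 2 * b * t + c) = t * √(1 + 2 * b * t⁻¹ + c * t⁻¹ ^ 2) := by
      rw [← Real.sqrt_sq ht.le, ← Real.sqrt_mul (by positivity), Real.sqrt_sq ht.le]
      congr 1
      field_simp
    rw [this]
    have h4 : 0 < √(1 + 2 * b * t⁻¹ + c * t⁻¹ ^ 2) := Real.sqrt_pos.2 (by positivity)
    field_simp

lemma lintegral_div_sqrt_quadratic (x y z D : ℝ) (hx : 1 ≤ x) (hy : 1 ≤ y) (hz : 1 ≤ z)
    (hD : 0 ≤ D) (hD2 : D ^ 2 = 1 + 2 * x * y * z - x ^ 2 - y ^ 2 - z ^ 2) :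
    ∫⁻ s in Ioi (0 : ℝ), ENNReal.ofReal
        (D / (√(s ^ 2 + 2 * z * s + 1) * (√(s ^ 2 + 2 * z * s + 1) + (y + x * s)))) =
      ENNReal.ofReal (2 * Real.arctan (D / (1 + x + y + z))) := by
  have hq (s : ℝ) (hs : 0 ≤ s) : 0 < s ^ 2 + 2 * z * s + 1 := by positivity
  -- With R² = ⟨a + sb, a + sb⟩, this antiderivative is the expected area 2 arctan(D'/S') of the
  -- subtriangle with corners a, (a + sb)/R, c, numerator and denominator multiplied by R.
  rw [lintegral_Ioi_of_hasDerivAt_of_nonneg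
    (f := fun s => 2 * Real.arctan (s * D / (√(s ^ 2 + 2 * z * s + 1) * (1 + y) + (1 + y)
      + s * (z + x)))) (l := 2 * Real.arctan (D / (1 + x + y + z)))]
  · simp
  · intro s hs
    have hs0 : 0 ≤ s := hs
    have hqs := hq s hs
    have hR : 0 < √(s ^ 2 + 2 * z * s + 1) := Real.sqrt_pos.2 hqs
    have hR2 : √(s ^ 2 + 2 * z * s + 1) ^ 2 = s ^ 2 + 2 * z * s + 1 := Real.sq_sqrt hqs.le
    have hE : 0 < √(s ^ 2 + 2 * z * s + 1) * (1 + y) + (1 + y) + s * (z + x) := by positivity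
    have hdR := hasDerivAt_sqrt_quadratic z 1 s hqs
    have hdE := ((hdR.mul_const (1 + y)).add_const (1 + y)).add
      ((hasDerivAt_id s).mul_const (z + x))
    refine (((((hasDerivAt_id s).mul_const D).div hdE hE.ne').arctan).const_mul 2).congr_deriv ?_
    simp only [id, Pi.add_apply, Pi.div_apply]
    set R := √(s ^ 2 + 2 * z * s + 1)
    have h1 : 0 < R + (y + x * s) := by positivity
    have h2 : 0 < (R * (1 + y) + (1 + y) + s * (z + x)) ^ 2 + (s * D) ^ 2 := by positivity
    -- The identity behind `sq_midpoint_scales`, for the subtriangle and scaled by R².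
    have key : 2 * (1 + y) * (1 + s * z + R) * (R + (y + x * s)) =
        (R * (1 + y) + (1 + y) + s * (z + x)) ^ 2 + (s * D) ^ 2 := by
      linear_combination (2 * (1 + y) - (1 + y) ^ 2) * hR2 - s ^ 2 * hD2
    have hnum : (R * (1 + y) + (1 + y) + s * (z + x)) - s * ((s + z) / R * (1 + y) + (z + x))
        = (1 + y) * (1 + s * z + R) / R := by
      field_simp
      linear_combination (1 + y) * hR2
    have hE' : R * (1 + y) + (1 + y) + s * (z + x) ≠ 0 := hE.ne'
    have e1 : (1 * D * (R * (1 + y) + (1 + y) + s * (z + x))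
        - s * D * ((s + z) / R * (1 + y) + 1 * (z + x))) =
        D * ((1 + y) * (1 + s * z + R) / R) := by
      rw [← hnum]; ring
    rw [e1]
    have e2 : 1 + (s * D / (R * (1 + y) + (1 + y) + s * (z + x))) ^ 2 =
        (2 * (1 + y) * (1 + s * z + R) * (R + (y + x * s))) /
          (R * (1 + y) + (1 + y) + s * (z + x)) ^ 2 := by
      rw [key]; field_simp
    rw [e2]
    have h3 : 0 < 1 + s * z + R := by positivity
    have h4 : 0 < 1 + y := by positivity
    field_simp
  · intro s hs
    have hs0 : 0 < s := hs
    positivity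
  · refine (Real.continuous_arctan.continuousAt.tendsto.comp ?_).const_mul 2
    have h1 : Tendsto (fun s : ℝ => D / (√(1 + 2 * z * s⁻¹ + s⁻¹ ^ 2) * (1 + y) + (1 + y) * s⁻¹
        + (z + x))) atTop (𝓝 (D / (1 + x + y + z))) := by
      have hcont : ContinuousAt (fun u : ℝ => D / (√(1 + 2 * z * u + u ^ 2) * (1 + y)
          + (1 + y) * u + (z + x))) 0 := by
        apply ContinuousAt.div (by fun_prop) (by fun_prop)
        simp
        positivity
      have := hcont.tendsto.comp tendsto_inv_atTop_zero
      convert! this using 2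
      simp
      ring
    refine h1.congr' ?_
    filter_upwards [eventually_gt_atTop 0] with s hs
    have : √(s ^ 2 + 2 * z * s + 1) = s * √(1 + 2 * z * s⁻¹ + s⁻¹ ^ 2) := by
      rw [← Real.sqrt_sq hs.le, ← Real.sqrt_mul (by positivity), Real.sqrt_sq hs.le]
      congr 1
      field_simp
    rw [this]
    have h4 : 0 < √(1 + 2 * z * s⁻¹ + s⁻¹ ^ 2) := Real.sqrt_pos.2 (by positivity)
    field_simp

/-- The area integral of a geodesic triangle in homogeneous coordinates. -/
lemma lintegral_quadrant_rpow_gram (x y z D : ℝ) (hx : 1 ≤ x) (hy : 1 ≤ y) (hz : 1 ≤ z)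
    (hD : 0 < D) (hD2 : D ^ 2 = 1 + 2 * x * y * z - x ^ 2 - y ^ 2 - z ^ 2) :
    ENNReal.ofReal D * ∫⁻ s in Ioi (0 : ℝ), ∫⁻ t in Ioi (0 : ℝ), ENNReal.ofReal
        (1 / √(t ^ 2 + 2 * (y + x * s) * t + (s ^ 2 + 2 * z * s + 1)) ^ 3) =
      ENNReal.ofReal (2 * Real.arctan (D / (1 + x + y + z))) := by
  rw [← lintegral_div_sqrt_quadratic x y z D hx hy hz hD.le hD2,
    ← lintegral_const_mul' _ _ ENNReal.ofReal_ne_top]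
  refine setLIntegral_congr_fun measurableSet_Ioi fun s hs => ?_
  have hs0 : 0 < s := hs
  have hlt : s ^ 2 + 2 * z * s + 1 < (y + x * s) ^ 2 := by
    -- Strict reversed Cauchy–Schwarz for c and a + sb, by completing the square in s; D ≠ 0 makes
    -- it strict.
    have h1 : (x ^ 2 - 1) * ((y + x * s) ^ 2 - (s ^ 2 + 2 * z * s + 1)) =
        ((x ^ 2 - 1) * s + (x * y - z)) ^ 2 + D ^ 2 := by
      linear_combination -hD2
    have h2 : 0 ≤ x ^ 2 - 1 := by nlinarith
    have h3 : 0 < (x ^ 2 - 1) * ((y + x * s) ^ 2 - (s ^ 2 + 2 * z * s + 1)) := by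
      rw [h1]; positivity
    linarith [pos_of_mul_pos_right h3 h2]
  rw [lintegral_rpow_quadratic _ _ (by positivity) (by positivity) hlt,
    ← ENNReal.ofReal_mul hD.le, mul_one_div]

/-! ### Volumes of solid cones and area in the Klein model -/

lemma lintegral_sq_le_one {Q : ℝ} (hQ : 0 < Q) :
    3 * ∫⁻ h in Ioi (0 : ℝ), {h : ℝ | h ^ 2 * Q ≤ 1}.indicator (fun h => ENNReal.ofReal (h ^ 2)) h =
      ENNReal.ofReal (1 / √Q ^ 3) := by
  have hsQ : 0 < √Q := Real.sqrt_pos.2 hQ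
  have hm : MeasurableSet {h : ℝ | h ^ 2 * Q ≤ 1} :=
    measurableSet_le (by fun_prop) measurable_const
  have hset : {h : ℝ | h ^ 2 * Q ≤ 1} ∩ Ioi 0 = Ioc 0 (1 / √Q) := by
    ext h
    simp only [mem_inter_iff, mem_ofPred_eq, mem_Ioi, mem_Ioc, and_comm (b := 0 < h)]
    refine and_congr_right fun hh => ?_
    rw [le_div_iff₀ hsQ, ← sq_le_one_iff₀ (a := h * √Q) (by positivity), mul_pow, Real.sq_sqrt hQ.le]
  rw [lintegral_indicator hm, Measure.restrict_restrict hm, hset,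
    ← ofReal_integral_eq_lintegral_ofReal]
  · rw [← intervalIntegral.integral_of_le (by positivity), integral_pow,
      show (3 : ENNReal) = ENNReal.ofReal 3 by simp, ← ENNReal.ofReal_mul (by norm_num)]
    congr 1
    norm_num
    field_simp
  · exact (Continuous.integrableOn_Icc (by fun_prop)).mono_set Ioc_subset_Icc_self
  · exact Eventually.of_forall fun h => sq_nonneg h

open scoped Pointwise in
/-- The volume of the part `q ≤ 1` of a cone, for a homogeneous function `q` of degree two, as an
integral over the section of the cone at height one. -/
lemma three_mul_volume_cone {E : Type*} [NormedAddCommGroup E] [NormedSpace ℝ E]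
    [FiniteDimensional ℝ E] [MeasurableSpace E] [BorelSpace E] (μ : Measure E)
    [μ.IsAddHaarMeasure] [SFinite μ] (hE : Module.finrank ℝ E = 2) {C : Set (E × ℝ)}
    {q : E × ℝ → ℝ} (hCm : MeasurableSet C) (hqm : Measurable q)
    (hC : ∀ h : ℝ, 0 < h → ∀ v, h • v ∈ C ↔ v ∈ C) (hq : ∀ (h : ℝ) v, q (h • v) = h ^ 2 * q v)
    (hC0 : ∀ v ∈ C, 0 ≤ v.2) (hpos : ∀ k : E, (k, (1 : ℝ)) ∈ C → 0 < q (k, 1)) :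
    3 * (μ.prod volume) (C ∩ {v | q v ≤ 1}) =
      ∫⁻ k, {k : E | (k, (1 : ℝ)) ∈ C}.indicator
        (fun k => ENNReal.ofReal (1 / √(q (k, 1)) ^ 3)) k ∂μ := by
  have hm : MeasurableSet (C ∩ {v | q v ≤ 1}) :=
    hCm.inter (measurableSet_le hqm measurable_const)
  have hKm : MeasurableSet {k : E | (k, (1 : ℝ)) ∈ C} := by
    exact measurable_prodMk_right hCm
  have hq1 : Measurable fun k : E => q (k, 1) := hqm.comp measurable_prodMk_right
  rw [Measure.prod_apply_symm hm]
  -- By homogeneity the slice at height h is a scaled part of the unit section, so its measure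
  -- acquires h²; integrating h² up to q(k,1)^(-1/2) produces the factor 1/3.
  have hslice (h : ℝ) (hh : 0 < h) : (fun k : E => (k, h)) ⁻¹' (C ∩ {v | q v ≤ 1}) =
      h • ({k : E | (k, (1 : ℝ)) ∈ C} ∩ {k : E | h ^ 2 * q (k, 1) ≤ 1}) := by
    ext k
    rw [mem_smul_set_iff_inv_smul_mem₀ hh.ne']
    have e : (k, h) = h • (h⁻¹ • k, (1 : ℝ)) := by
      simp [smul_smul, hh.ne']
    simp only [mem_preimage, mem_inter_iff, mem_ofPred_eq]
    rw [e, hC h hh, hq]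
  have hneg : ∀ h ∈ (Ioi (0 : ℝ))ᶜ, h ≠ 0 →
      μ ((fun k : E => (k, h)) ⁻¹' (C ∩ {v | q v ≤ 1})) = 0 := by
    intro h hh h0
    have hlt : h < 0 := lt_of_le_of_ne (not_lt.1 hh) h0
    convert! measure_empty (μ := μ)
    ext k
    simp only [mem_preimage, mem_inter_iff, mem_empty_iff_false, iff_false, not_and]
    intro hk
    exact absurd (hC0 _ hk) (not_le.2 hlt)
  have hzero : ∫⁻ h in (Ioi (0 : ℝ))ᶜ, μ ((fun k : E => (k, h)) ⁻¹' (C ∩ {v | q v ≤ 1})) = 0 := by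
    rw [lintegral_eq_zero_iff (measurable_measure_prodMk_right hm)]
    have h0 : ∀ᵐ h : ℝ, h ≠ 0 := by simp [ae_iff]
    exact (ae_restrict_iff' measurableSet_Ioi.compl).2 (h0.mono fun h h1 h2 => hneg h h2 h1)
  rw [← lintegral_add_compl _ (measurableSet_Ioi (a := (0 : ℝ))), hzero, add_zero]
  have hsl : ∀ h ∈ Ioi (0 : ℝ), μ ((fun k : E => (k, h)) ⁻¹' (C ∩ {v | q v ≤ 1})) =
      ∫⁻ k, {k : E | (k, (1 : ℝ)) ∈ C}.indicator (fun k => {h : ℝ | h ^ 2 * q (k, 1) ≤ 1}.indicator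
        (fun h => ENNReal.ofReal (h ^ 2)) h) k ∂μ := by
    intro h hh
    have hh0 : 0 < h := hh
    rw [hslice h hh, Measure.addHaar_smul, hE, abs_of_nonneg (by positivity), lintegral_indicator hKm]
    have e (k : E) : {h : ℝ | h ^ 2 * q (k, 1) ≤ 1}.indicator (fun h => ENNReal.ofReal (h ^ 2)) h =
        {k : E | h ^ 2 * q (k, 1) ≤ 1}.indicator (fun _ => ENNReal.ofReal (h ^ 2)) k := by
      simp only [indicator, mem_ofPred_eq]
    simp_rw [e]
    have hm2 : MeasurableSet {k : E | h ^ 2 * q (k, 1) ≤ 1} :=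
      measurableSet_le (hq1.const_mul _) measurable_const
    rw [lintegral_indicator hm2, setLIntegral_const, Measure.restrict_apply hm2, inter_comm]
  rw [setLIntegral_congr_fun measurableSet_Ioi hsl, lintegral_lintegral_swap, ←
    lintegral_const_mul']
  · refine lintegral_congr fun k => ?_
    by_cases hk : (k, (1 : ℝ)) ∈ C
    · simp only [indicator_of_mem (show k ∈ {k : E | (k, (1 : ℝ)) ∈ C} from hk)]
      exact lintegral_sq_le_one (hpos k hk)
    · simp [indicator_of_notMem (show k ∉ {k : E | (k, (1 : ℝ)) ∈ C} from hk)]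
  · simp
  · have hW : MeasurableSet {p : ℝ × E | (p.2, (1 : ℝ)) ∈ C ∧ p.1 ^ 2 * q (p.2, 1) ≤ 1} := by
      apply MeasurableSet.inter
      · exact measurable_snd hKm
      · exact measurableSet_le ((measurable_fst.pow_const 2).mul (hq1.comp measurable_snd))
          measurable_const
    have : Measurable ({p : ℝ × E | (p.2, (1 : ℝ)) ∈ C ∧ p.1 ^ 2 * q (p.2, 1) ≤ 1}.indicator
        fun p => ENNReal.ofReal (p.1 ^ 2)) :=
      Measurable.indicator (by fun_prop) hW
    refine this.aemeasurable.congr (Eventually.of_forall ?_)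
    rintro ⟨h, k⟩
    simp only [indicator, mem_ofPred_eq, Function.uncurry]
    by_cases h1 : (k, (1 : ℝ)) ∈ C <;> simp [h1]

/-- The substitution `r = tanh θ`. -/
lemma lintegral_tanh_substitution (f : ℝ → ENNReal) (hf : ∀ r, 1 ≤ r → f r = 0) :
    ∫⁻ r in Ioi (0 : ℝ), f r =
      ∫⁻ θ in Ioi (0 : ℝ), ENNReal.ofReal (1 / Real.cosh θ ^ 2) * f (Real.tanh θ) := by
  have himg : Real.tanh '' Ioi 0 = Ioo 0 1 := by
    ext r
    constructor
    · rintro ⟨θ, hθ, rfl⟩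
      exact ⟨by rw [Real.tanh_eq_sinh_div_cosh]
                exact div_pos (Real.sinh_pos_iff.2 hθ) (Real.cosh_pos θ), Real.tanh_lt_one θ⟩
    · rintro hr
      exact ⟨Real.artanh r, Real.artanh_pos hr, Real.tanh_artanh ⟨by linarith [hr.1], hr.2⟩⟩
  have hd (θ : ℝ) : HasDerivAt Real.tanh (1 / Real.cosh θ ^ 2) θ := by
    have h := (Real.hasDerivAt_sinh θ).div (Real.hasDerivAt_cosh θ) (Real.cosh_pos θ).ne'
    have e : Real.tanh = Real.sinh / Real.cosh := by
      ext x; exact Real.tanh_eq_sinh_div_cosh x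
    rw [e]
    refine h.congr_deriv ?_
    congr 1
    linarith [Real.cosh_sq θ]
  have hmono : MonotoneOn Real.tanh (Ioi 0) := by
    have : Monotone Real.tanh := monotone_of_deriv_nonneg (fun θ => (hd θ).differentiableAt)
      fun θ => by rw [(hd θ).deriv]; positivity
    exact this.monotoneOn _
  rw [← lintegral_image_eq_lintegral_deriv_mul_of_monotoneOn measurableSet_Ioi
    (fun θ _ => (hd θ).hasDerivWithinAt) hmono, himg]
  have : (Ioi (0 : ℝ)) = Ioo 0 1 ∪ Ici 1 := (Ioo_union_Ici_eq_Ioi one_pos).symm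
  rw [this, lintegral_union measurableSet_Ici (by
    rw [Set.disjoint_left]; intro x hx hx'; exact absurd hx.2 (not_lt.2 hx'))]
  rw [setLIntegral_congr_fun (g := fun _ => 0) measurableSet_Ici fun r hr => hf r hr]
  simp

lemma lorentz_section (k : ℂ) : lorentz (k, 1) (k, 1) = 1 - ‖k‖ ^ 2 := by
  rw [← Complex.normSq_eq_norm_sq, Complex.normSq_apply, lorentz_eq]
  ring

lemma continuous_lorentz_self : Continuous fun v : ℂ × ℝ => lorentz v v := by
  simp only [lorentz_eq]
  fun_prop

lemma continuous_hyperbolicCoord : Continuous hyperbolicCoord := by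
  unfold hyperbolicCoord
  fun_prop

lemma hyperbolicCoord_eq_smul (θ φ : ℝ) : hyperbolicCoord (θ, φ) =
    Real.cosh θ • ((Complex.polarCoord.symm (Real.tanh θ, φ) : ℂ), (1 : ℝ)) := by
  have h := (Real.cosh_pos θ).ne'
  ext1
  · simp only [hyperbolicCoord, Complex.polarCoord_symm_apply, Prod.smul_fst, Complex.real_smul,
      Real.tanh_eq_sinh_div_cosh]
    rw [mul_comm Complex.I, Complex.exp_mul_I]
    have h' : (Real.cosh θ : ℂ) ≠ 0 := by exact_mod_cast h
    push_cast at h' ⊢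
    field_simp
  · simp [hyperbolicCoord]

lemma hyperbolicCoord_mem_sheet (θ φ : ℝ) : 0 < (hyperbolicCoord (θ, φ)).2 ∧
    (hyperbolicCoord (θ, φ)).2 ^ 2 - ‖(hyperbolicCoord (θ, φ)).1‖ ^ 2 = 1 := by
  refine ⟨Real.cosh_pos θ, ?_⟩
  simp only [hyperbolicCoord]
  rw [norm_mul, mul_comm Complex.I, Complex.norm_exp_ofReal_mul_I, mul_one, Complex.norm_real,
    Real.norm_eq_abs, sq_abs]
  linarith [Real.cosh_sq θ]

/-- The hyperbolic area of the part of the hyperboloid in a cone, in the Klein model. -/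
lemma hyperbolicArea_sheet_inter_cone {C : Set (ℂ × ℝ)} (hCm : MeasurableSet C)
    (hC : ∀ h : ℝ, 0 < h → ∀ v, h • v ∈ C ↔ v ∈ C)
    (hpos : ∀ k : ℂ, (k, (1 : ℝ)) ∈ C → 0 < lorentz (k, 1) (k, 1)) :
    hyperbolicArea ({x | 0 < x.2 ∧ x.2 ^ 2 - ‖x.1‖ ^ 2 = 1} ∩ C) =
      ∫⁻ k : ℂ, {k : ℂ | (k, (1 : ℝ)) ∈ C}.indicator
        (fun k => ENNReal.ofReal (1 / √(lorentz (k, 1) (k, 1)) ^ 3)) k := by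
  have hKm : MeasurableSet {k : ℂ | (k, (1 : ℝ)) ∈ C} := by
    exact measurable_prodMk_right hCm
  set F : ℂ → ENNReal := {k : ℂ | (k, (1 : ℝ)) ∈ C}.indicator
    (fun k => ENNReal.ofReal (1 / √(lorentz (k, 1) (k, 1)) ^ 3)) with hF
  have hFm : Measurable F := by
    refine Measurable.indicator ?_ hKm
    simp only [lorentz_section]
    fun_prop
  have hSm : MeasurableSet ({x : ℂ × ℝ | 0 < x.2 ∧ x.2 ^ 2 - ‖x.1‖ ^ 2 = 1} ∩ C) := by
    refine MeasurableSet.inter (MeasurableSet.inter ?_ ?_) hCm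
    · exact measurableSet_lt measurable_const measurable_snd
    · exact measurableSet_eq_fun (by fun_prop) measurable_const
  have hpre : MeasurableSet (hyperbolicCoord ⁻¹'
      ({x : ℂ × ℝ | 0 < x.2 ∧ x.2 ^ 2 - ‖x.1‖ ^ 2 = 1} ∩ C)) :=
    continuous_hyperbolicCoord.measurable hSm
  have hsinh : Measurable fun x : ℝ × ℝ => ENNReal.ofReal (Real.sinh x.1) := by fun_prop
  have hpol : Measurable fun p : ℝ × ℝ => (Complex.polarCoord.symm p : ℂ) := by
    simp only [Complex.polarCoord_symm_apply]
    fun_prop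
  rw [hyperbolicArea, Measure.map_apply continuous_hyperbolicCoord.measurable hSm,
    withDensity_apply _ hpre, ← lintegral_indicator hpre, ← Complex.lintegral_comp_polarCoord_symm,
    polarCoord_target, Measure.volume_eq_prod, ← Measure.prod_restrict,
    lintegral_prod_symm' _ (hsinh.indicator hpre), lintegral_prod_symm' _ (by
      simp only [smul_eq_mul]
      exact (by fun_prop : Measurable fun p : ℝ × ℝ => ENNReal.ofReal p.1).mul (hFm.comp hpol))]
  refine lintegral_congr fun φ => ?_
  simp only [smul_eq_mul]
  rw [lintegral_tanh_substitution
    (fun r => ENNReal.ofReal r * F (Complex.polarCoord.symm (r, φ)))]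
  · refine setLIntegral_congr_fun measurableSet_Ioi fun θ hθ => ?_
    have hθ0 : 0 < θ := hθ
    have hc := Real.cosh_pos θ
    have hmem : (θ, φ) ∈ hyperbolicCoord ⁻¹'
        ({x : ℂ × ℝ | 0 < x.2 ∧ x.2 ^ 2 - ‖x.1‖ ^ 2 = 1} ∩ C) ↔
        (Complex.polarCoord.symm (Real.tanh θ, φ) : ℂ) ∈ {k : ℂ | (k, (1 : ℝ)) ∈ C} := by
      rw [mem_preimage, mem_inter_iff, hyperbolicCoord_eq_smul, hC _ hc,
        ← hyperbolicCoord_eq_smul]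
      exact and_iff_right (hyperbolicCoord_mem_sheet θ φ)
    by_cases h : (Complex.polarCoord.symm (Real.tanh θ, φ) : ℂ) ∈ {k : ℂ | (k, (1 : ℝ)) ∈ C}
    · rw [indicator_of_mem (hmem.2 h), hF, indicator_of_mem h, lorentz_section,
        Complex.norm_polarCoord_symm, sq_abs]
      have ht : 1 - Real.tanh θ ^ 2 = (1 / Real.cosh θ) ^ 2 := by
        rw [Real.tanh_eq_sinh_div_cosh]
        field_simp
        linarith [Real.cosh_sq θ]
      have ht0 : 0 ≤ Real.tanh θ := by
        rw [Real.tanh_eq_sinh_div_cosh]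
        exact div_nonneg (Real.sinh_pos_iff.2 hθ0).le hc.le
      rw [ht, Real.sqrt_sq (by positivity), ← ENNReal.ofReal_mul ht0,
        ← ENNReal.ofReal_mul (by positivity)]
      -- Jacobian sech²θ, polar factor tanh θ and Klein density cosh³θ multiply to sinh θ.
      congr 1
      rw [Real.tanh_eq_sinh_div_cosh]
      field_simp
    · rw [indicator_of_notMem (fun h' => h (hmem.1 h')), hF, indicator_of_notMem h]
      simp
  · intro r hr
    rw [hF, indicator_of_notMem, mul_zero]
    intro h
    have := hpos _ h
    rw [lorentz_section, Complex.norm_polarCoord_symm, sq_abs] at this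
    nlinarith

/-- The linear combinations of three vectors. -/
noncomputable def combination (a b c : ℂ × ℝ) : (ℝ × ℝ) × ℝ →ₗ[ℝ] ℂ × ℝ where
  toFun u := u.2 • a + u.1.1 • b + u.1.2 • c
  map_add' u v := by simp only [Prod.fst_add, Prod.snd_add]; module
  map_smul' s u := by simp only [Prod.smul_fst, Prod.smul_snd, smul_eq_mul, RingHom.id_apply]; module

lemma combination_apply (a b c : ℂ × ℝ) (u : (ℝ × ℝ) × ℝ) :
    combination a b c u = u.2 • a + u.1.1 • b + u.1.2 • c := rfl

/-- Cramer's rule recovers the coefficients. -/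
lemma combination_injective {a b c : ℂ × ℝ} (h : det3 a b c ≠ 0) :
    Function.Injective (combination a b c) := by
  have h1 (u : (ℝ × ℝ) × ℝ) : det3 (combination a b c u) b c = u.2 * det3 a b c := by
    simp [combination_apply, det3_eq]; ring
  have h2 (u : (ℝ × ℝ) × ℝ) : det3 a (combination a b c u) c = u.1.1 * det3 a b c := by
    simp [combination_apply, det3_eq]; ring
  have h3 (u : (ℝ × ℝ) × ℝ) : det3 a b (combination a b c u) = u.1.2 * det3 a b c := by
    simp [combination_apply, det3_eq]; ring
  intro u v huv
  refine Prod.ext (Prod.ext ?_ ?_) ?_ <;> apply mul_right_cancel₀ h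
  · rw [← h2, ← h2, huv]
  · rw [← h3, ← h3, huv]
  · rw [← h1, ← h1, huv]

/-- The coordinates of `ℝ³`. -/
def prodEquivFin : ((ℝ × ℝ) × ℝ) ≃ₗ[ℝ] (Fin 3 → ℝ) where
  toFun u := ![u.1.1, u.1.2, u.2]
  invFun f := ((f 0, f 1), f 2)
  map_add' u v := by ext i; fin_cases i <;> simp
  map_smul' s u := by ext i; fin_cases i <;> simp
  left_inv u := by simp
  right_inv f := by ext i; fin_cases i <;> simp

instance isAddHaarMeasure_volume_real_prod :
    (volume : Measure (ℝ × ℝ)).IsAddHaarMeasure :=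
  Measure.prod.instIsAddHaarMeasure _ _

instance isAddHaarMeasure_volume_real_prod_prod :
    (volume : Measure ((ℝ × ℝ) × ℝ)).IsAddHaarMeasure :=
  Measure.prod.instIsAddHaarMeasure _ _

lemma volume_image_combination (a b c : ℂ × ℝ) (S : Set ((ℝ × ℝ) × ℝ)) :
    volume (combination a b c '' S) = ENNReal.ofReal |det3 a b c| * volume S := by
  let e : (ℂ × ℝ) ≃ₗ[ℝ] (ℝ × ℝ) × ℝ := Complex.equivRealProdLm.prodCongr (LinearEquiv.refl ℝ ℝ)
  let f : (ℂ × ℝ) ≃ᵐ (ℝ × ℝ) × ℝ :=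
    Complex.measurableEquivRealProd.prodCongr (MeasurableEquiv.refl ℝ)
  have hf : MeasurePreserving f :=
    Complex.volume_preserving_equiv_real_prod.prod (MeasurePreserving.id volume)
  have himg : f ⁻¹' ((e.toLinearMap ∘ₗ combination a b c) '' S) = combination a b c '' S := by
    have hfe : (f : ℂ × ℝ → (ℝ × ℝ) × ℝ) = e := rfl
    rw [hfe, LinearMap.coe_comp, image_comp]
    exact preimage_image_eq _ e.injective
  -- The basis vectors map to b, c, a in this order, an even permutation of a, b, c.
  have hdet : LinearMap.det (e.toLinearMap ∘ₗ combination a b c) = det3 a b c := by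
    let bas : Module.Basis (Fin 3) ℝ ((ℝ × ℝ) × ℝ) := Module.Basis.ofEquivFun prodEquivFin
    rw [← LinearMap.det_toMatrix bas, Matrix.det_fin_three]
    simp [LinearMap.toMatrix_apply, bas, prodEquivFin, e, combination_apply, det3_eq]
    ring
  rw [← himg, hf.measure_preimage_equiv, Measure.addHaar_image_linearMap, hdet]

/-- The closed octant of `ℝ³`. -/
def octant : Set ((ℝ × ℝ) × ℝ) := {u | 0 ≤ u.1.1 ∧ 0 ≤ u.1.2 ∧ 0 ≤ u.2}

lemma isClosed_octant : IsClosed octant := by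
  refine IsClosed.inter ?_ (IsClosed.inter ?_ ?_)
  · exact isClosed_le continuous_const continuous_fst.fst
  · exact isClosed_le continuous_const continuous_fst.snd
  · exact isClosed_le continuous_const continuous_snd

lemma smul_mem_octant {h : ℝ} (hh : 0 < h) {u : (ℝ × ℝ) × ℝ} : h • u ∈ octant ↔ u ∈ octant := by
  simp [octant, hh]

/-! ### Area of a geodesic triangle -/

namespace HyperbolicTriangle

variable (T : HyperbolicTriangle)

/-- The convex cone spanned by the corners. -/
def cone : Set (ℂ × ℝ) := combination T.a.1 T.b.1 T.c.1 '' octant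

lemma region_eq : T.region = {x | 0 < x.2 ∧ x.2 ^ 2 - ‖x.1‖ ^ 2 = 1} ∩ T.cone := by
  ext x
  refine and_congr_right fun _ => ?_
  constructor
  · rintro ⟨r, s, t, hr, hs, ht, rfl⟩
    exact ⟨((s, t), r), ⟨hs, ht, hr⟩, rfl⟩
  · rintro ⟨u, ⟨hs, ht, hr⟩, rfl⟩
    exact ⟨u.2, u.1.1, u.1.2, hr, hs, ht, rfl⟩

lemma smul_mem_cone {h : ℝ} (hh : 0 < h) (v : ℂ × ℝ) : h • v ∈ T.cone ↔ v ∈ T.cone := by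
  have key (h : ℝ) (hh : 0 < h) (v : ℂ × ℝ) (hv : v ∈ T.cone) : h • v ∈ T.cone := by
    obtain ⟨u, hu, rfl⟩ := hv
    exact ⟨h • u, (smul_mem_octant hh).2 hu, map_smul _ _ _⟩
  refine ⟨fun hv => ?_, key h hh v⟩
  have := key h⁻¹ (inv_pos.2 hh) _ hv
  rwa [smul_smul, inv_mul_cancel₀ hh.ne', one_smul] at this

lemma lorentz_combination (u : (ℝ × ℝ) × ℝ) :
    lorentz (combination T.a.1 T.b.1 T.c.1 u) (combination T.a.1 T.b.1 T.c.1 u) =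
      u.2 ^ 2 + u.1.1 ^ 2 + u.1.2 ^ 2 + 2 * (lorentz T.b.1 T.c.1 * (u.1.1 * u.1.2)
        + lorentz T.c.1 T.a.1 * (u.1.2 * u.2) + lorentz T.a.1 T.b.1 * (u.2 * u.1.1)) := by
  simp only [combination_apply, lorentz_add_left, lorentz_add_right, lorentz_smul_left,
    lorentz_smul_right, T.a.lorentz_self, T.b.lorentz_self, T.c.lorentz_self,
    lorentz_comm T.b.1 T.a.1, lorentz_comm T.c.1 T.b.1, lorentz_comm T.a.1 T.c.1]
  ring

lemma snd_nonneg_of_mem_cone {v : ℂ × ℝ} (hv : v ∈ T.cone) : 0 ≤ v.2 := by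
  obtain ⟨u, ⟨hs, ht, hr⟩, rfl⟩ := hv
  have ha := T.a.2.1.le
  have hb := T.b.2.1.le
  have hc := T.c.2.1.le
  simp only [combination_apply, Prod.snd_add, Prod.smul_snd, smul_eq_mul]
  positivity

/-- On the octant the cross terms are nonnegative, so the form dominates the sum of squares. -/
lemma lorentz_combination_pos {u : (ℝ × ℝ) × ℝ} (hu : u ∈ octant) (h0 : u ≠ 0) :
    0 < lorentz (combination T.a.1 T.b.1 T.c.1 u) (combination T.a.1 T.b.1 T.c.1 u) := by
  obtain ⟨hs, ht, hr⟩ := hu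
  have hx := zero_le_one.trans (T.b.one_le_lorentz T.c)
  have hy := zero_le_one.trans (T.c.one_le_lorentz T.a)
  have hz := zero_le_one.trans (T.a.one_le_lorentz T.b)
  rw [lorentz_combination]
  have h1 : 0 < u.2 ^ 2 + u.1.1 ^ 2 + u.1.2 ^ 2 := by
    by_contra! h
    apply h0
    refine Prod.ext (Prod.ext ?_ ?_) ?_ <;> simp only [Prod.fst_zero, Prod.snd_zero] <;>
      nlinarith [sq_nonneg u.2, sq_nonneg u.1.1, sq_nonneg u.1.2]
  positivity

lemma lorentz_pos_of_mem_cone {v : ℂ × ℝ} (hv : v ∈ T.cone) (h0 : v ≠ 0) : 0 < lorentz v v := by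
  obtain ⟨u, hu, rfl⟩ := hv
  refine T.lorentz_combination_pos hu ?_
  rintro rfl
  exact h0 (map_zero _)

lemma measurableSet_cone (h : T.det ≠ 0) : MeasurableSet T.cone := by
  have hinj := combination_injective h
  exact ((LinearMap.isClosedEmbedding_of_injective (LinearMap.ker_eq_bot.2 hinj)).isClosedMap _
    isClosed_octant).measurableSet

/-- The area of a nondegenerate geodesic triangle. -/
theorem hyperbolicArea_region (h : T.det ≠ 0) : hyperbolicArea T.region =
    ENNReal.ofReal (2 * Real.arctan (|T.det| / T.coshSum)) := by
  set L := combination T.a.1 T.b.1 T.c.1 with hL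
  have hLc : Continuous L := L.continuous_of_finiteDimensional
  have h10 {E : Type} [Zero E] (k : E) : (k, (1 : ℝ)) ≠ 0 := by
    intro h
    simpa using congrArg Prod.snd h
  have himg : T.cone ∩ {v | lorentz v v ≤ 1} =
      L '' (octant ∩ {u | lorentz (L u) (L u) ≤ 1}) := by
    rw [cone, ← hL]
    exact image_inter_preimage L octant {v | lorentz v v ≤ 1} |>.symm
  -- The cone formula is used on both sides of the linear map: here it gives the Klein area
  -- integral, and on the octant the quadrant integral with the coefficient of a equal to 1.
  have hcone := three_mul_volume_cone (volume : Measure ℂ) Complex.finrank_real_complex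
    (C := T.cone) (q := fun v => lorentz v v) (T.measurableSet_cone h)
    continuous_lorentz_self.measurable (fun _ hh v => T.smul_mem_cone hh v)
    (fun h v => by simp only [lorentz_smul_left, lorentz_smul_right]; ring)
    (fun v hv => T.snd_nonneg_of_mem_cone hv) (fun k hk => T.lorentz_pos_of_mem_cone hk (h10 k))
  have hoct := three_mul_volume_cone (volume : Measure (ℝ × ℝ)) (by simp)
    (C := octant) (q := fun u => lorentz (L u) (L u)) isClosed_octant.measurableSet
    (continuous_lorentz_self.comp hLc).measurable (fun _ hh v => smul_mem_octant hh)
    (fun h v => by simp only [map_smul, lorentz_smul_left, lorentz_smul_right]; ring)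
    (fun v hv => hv.2.2) (fun k hk => T.lorentz_combination_pos hk (h10 k))
  rw [region_eq, hyperbolicArea_sheet_inter_cone (T.measurableSet_cone h)
    (fun _ hh v => T.smul_mem_cone hh v) (fun k hk => T.lorentz_pos_of_mem_cone hk (h10 k)),
    ← hcone, himg, ← Measure.volume_eq_prod, volume_image_combination, mul_left_comm,
    Measure.volume_eq_prod, hoct]
  rw [coshSum, ← lintegral_quadrant_rpow_gram _ _ _ _ (T.b.one_le_lorentz T.c)
    (T.c.one_le_lorentz T.a) (T.a.one_le_lorentz T.b) (abs_pos.2 h)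
    (by rw [sq_abs, T.det_sq])]
  change ENNReal.ofReal |T.det| * _ = _
  congr 1
  have hset : {k : ℝ × ℝ | (k, (1 : ℝ)) ∈ octant} = Ici 0 ×ˢ Ici 0 := by
    ext k
    simp only [octant, mem_ofPred_eq, mem_prod, mem_Ici, zero_le_one, and_true]
  have hmeas : Measurable fun k : ℝ × ℝ =>
      ENNReal.ofReal (1 / √(lorentz (L (k, 1)) (L (k, 1))) ^ 3) := by
    have : Measurable fun k : ℝ × ℝ => lorentz (L (k, 1)) (L (k, 1)) :=
      ((continuous_lorentz_self.comp hLc).comp (by fun_prop)).measurable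
    fun_prop
  rw [hset, lintegral_indicator (measurableSet_Ici.prod measurableSet_Ici), 
    Measure.volume_eq_prod, ← Measure.prod_restrict,
    ← Measure.restrict_congr_set (Ioi_ae_eq_Ici (μ := volume) (a := (0 : ℝ))),
    lintegral_prod _ hmeas.aemeasurable]
  refine lintegral_congr fun s => lintegral_congr fun t => ?_
  rw [hL, lorentz_combination]
  congr 4
  ring

end HyperbolicTriangle

end

/-! ### Oriented area as an argument -/

namespace HyperbolicTriangle

/-- Oddness of arctan absorbs the orientation sign; for D = 0 the sign factor is zero, so the
measure of the degenerate region is not needed. -/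
theorem orientedArea_eq (T : HyperbolicTriangle) :
    T.orientedArea = 2 * Real.arctan (T.det / T.coshSum) := by
  have hS := T.coshSum_pos
  change Real.sign T.det * _ = _
  rcases eq_or_ne T.det 0 with h0 | h0
  · simp [h0]
  · have harc : 0 ≤ 2 * Real.arctan (|T.det| / T.coshSum) :=
      mul_nonneg zero_le_two (Real.arctan_nonneg.2 (by positivity))
    rw [T.hyperbolicArea_region h0, ENNReal.toReal_ofReal harc]
    rcases h0.lt_or_gt with h | h
    · rw [Real.sign_of_neg h, abs_of_neg h, neg_div, Real.arctan_neg]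
      ring
    · rw [Real.sign_of_pos h, abs_of_pos h, one_mul]

lemma orientedArea_mem_Ioo (T : HyperbolicTriangle) :
    T.orientedArea ∈ Set.Ioo (-Real.pi) Real.pi := by
  rw [T.orientedArea_eq]
  constructor
  · linarith [Real.neg_pi_div_two_lt_arctan (T.det / T.coshSum)]
  · linarith [Real.arctan_lt_pi_div_two (T.det / T.coshSum)]

lemma sqrt_one_add_div_sq (T : HyperbolicTriangle) :
    √(1 + (T.det / T.coshSum) ^ 2) = √(T.coshSum ^ 2 + T.det ^ 2) / T.coshSum := by
  have hS := T.coshSum_pos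
  rw [eq_div_iff hS.ne']
  conv_lhs => rw [← Real.sqrt_sq hS.le, ← Real.sqrt_mul (by positivity), Real.sqrt_sq hS.le]
  congr 1
  field_simp

lemma exp_half_orientedArea (T : HyperbolicTriangle) :
    Complex.exp (Complex.I * ((T.orientedArea / 2 : ℝ) : ℂ)) =
      ((T.coshSum / √(T.coshSum ^ 2 + T.det ^ 2) : ℝ) : ℂ) +
        Complex.I * ((T.det / √(T.coshSum ^ 2 + T.det ^ 2) : ℝ) : ℂ) := by
  have hS := T.coshSum_pos
  have hR : 0 < √(T.coshSum ^ 2 + T.det ^ 2) := Real.sqrt_pos.2 (by positivity)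
  rw [T.orientedArea_eq, mul_div_cancel_left₀ _ two_ne_zero, mul_comm Complex.I,
    Complex.exp_mul_I, ← Complex.ofReal_cos, ← Complex.ofReal_sin, Real.cos_arctan,
    Real.sin_arctan, sqrt_one_add_div_sq, mul_comm Complex.I]
  rw [one_div_div, div_div_div_cancel_right₀ hS.ne']

end HyperbolicTriangle

theorem mainTheorem2 (α β γ : HyperbolicPlane) :
    ((∃ T : HyperbolicTriangle, T.HasMidpoints α β γ) ↔ |det3 α.1 β.1 γ.1| < 1) ∧
    (|det3 α.1 β.1 γ.1| < 1 → ∃! T : HyperbolicTriangle, T.HasMidpoints α β γ) ∧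
    (∀ T : HyperbolicTriangle, T.HasMidpoints α β γ →
      T.orientedArea ∈ Set.Ioo (-Real.pi) Real.pi ∧
      Complex.exp (Complex.I * ((T.orientedArea / 2 : ℝ) : ℂ)) =
        (Real.sqrt (1 - det3 α.1 β.1 γ.1 ^ 2) : ℂ) + Complex.I * (det3 α.1 β.1 γ.1 : ℂ)) := by
  refine ⟨⟨fun ⟨T, hT⟩ => hT.abs_det3_lt_one, HyperbolicTriangle.exists_hasMidpoints⟩,
    fun h => ?_, fun T hT => ⟨T.orientedArea_mem_Ioo, ?_⟩⟩
  · obtain ⟨T, hT⟩ := HyperbolicTriangle.exists_hasMidpoints h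
    exact ⟨T, hT, fun T' hT' => hT'.unique hT⟩
  · rw [hT.sqrt_one_sub_det3_sq, hT.det3_eq_div, T.exp_half_orientedArea]
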